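/- Let $c>0$ be a real number and let $Q_c$ be the operator on $L^2([-1,1])$ with the sinc kernel, $$Q_cf(x)=\int_{-1}^1\frac{\sin (c(x-y))}{\pi(x-y)}\,f(y)\,dy .$$ Let $\lambda_1(c)\ge\lambda_2(c)\ge\cdots$ be the eigenvalues of $Q_c$, repeated according to multiplicity and arranged in decreasing order, so that for an integer $n\ge 1$ the number $\lambda_n(c)$ is the $n$-th largest eigenvalue of $Q_c$. Let $n\ge1$ be an integer. If $n>\frac{2c}{\pi}$, then $$\lambda_n(c)\ \ge\ 7\left(1-\frac{2c}{n\pi}\right)^2\left(\frac{c}{7\pi n}\right)^{2n-1}.$$ If $n=\left\lfloor\frac{2c}{\pi}\right\rfloor$, then $$\lambda_n(c)\ \ge\ \frac{4}{\pi+2c}.$$ -/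

import Mathlib

open MeasureTheory

noncomputable section

namespace Prolate

/-- Lebesgue measure on the interval `[-1, 1]`. -/
abbrev vol : Measure ℝ := volume.restrict (Set.Icc (-1 : ℝ) 1)

/-- The Hilbert space `L²([-1, 1])` of complex-valued functions. -/
abbrev L2 : Type := Lp ℂ 2 vol

/-- The sinc kernel `sin (c (x - y)) / (π (x - y))`, with its continuous value `c / π` on the
diagonal. -/
def kernel (c x y : ℝ) : ℝ :=
  if x = y then c / Real.pi else Real.sin (c * (x - y)) / (Real.pi * (x - y))

theorem kernel_eq_sinc (c x y : ℝ) :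
    kernel c x y = c / Real.pi * Real.sinc (c * (x - y)) := by
  unfold kernel
  split_ifs with h
  · simp [h]
  · have h1 : x - y ≠ 0 := sub_ne_zero.2 h
    rcases eq_or_ne c 0 with rfl | hc
    · simp
    · rw [Real.sinc_of_ne_zero (mul_ne_zero hc h1)]
      have := Real.pi_ne_zero
      field_simp

theorem continuous_kernel (c : ℝ) : Continuous fun p : ℝ × ℝ => kernel c p.1 p.2 := by
  simp only [kernel_eq_sinc]
  have := Real.continuous_sinc
  fun_prop

theorem abs_kernel_le (c x y : ℝ) : |kernel c x y| ≤ |c| / Real.pi := by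
  rw [kernel_eq_sinc, abs_mul, abs_div, abs_of_pos Real.pi_pos]
  exact mul_le_of_le_one_right (by positivity) (Real.abs_sinc_le_one _)

/-- The function `x ↦ ∫_{-1}^{1} sin (c (x - y)) / (π (x - y)) f(y) dy`. -/
def integralTransform (c : ℝ) (f : ℝ → ℂ) (x : ℝ) : ℂ :=
  ∫ y in Set.Icc (-1 : ℝ) 1, (kernel c x y : ℂ) * f y

theorem integrable_coe (f : L2) : Integrable f vol :=
  (Lp.memLp f).integrable (by norm_num)

theorem integrable_kernel_mul (c x : ℝ) (f : L2) :
    Integrable (fun y => (kernel c x y : ℂ) * f y) vol := by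
  refine (integrable_coe f).bdd_mul (c := |c| / Real.pi) ?_ ?_
  · have : Continuous fun y => (kernel c x y : ℂ) :=
      Complex.continuous_ofReal.comp ((continuous_kernel c).comp (by fun_prop : Continuous fun y => (x, y)))
    exact this.aestronglyMeasurable
  · exact Filter.Eventually.of_forall fun y => by simpa using abs_kernel_le c x y

theorem norm_integralTransform_le (c x : ℝ) (f : L2) :
    ‖integralTransform c f x‖ ≤ |c| / Real.pi * ∫ y, ‖f y‖ ∂vol := by
  rw [← integral_const_mul]
  refine norm_integral_le_of_norm_le ((integrable_coe f).norm.const_mul _) ?_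
  refine Filter.Eventually.of_forall fun y => ?_
  rw [norm_mul]
  exact mul_le_mul_of_nonneg_right (by simpa using abs_kernel_le c x y) (norm_nonneg _)

theorem continuous_integralTransform (c : ℝ) (f : L2) :
    Continuous (integralTransform c f) := by
  refine continuous_of_dominated (bound := fun y => |c| / Real.pi * ‖f y‖)
    (fun x => (integrable_kernel_mul c x f).aestronglyMeasurable) ?_
    ((integrable_coe f).norm.const_mul _) ?_
  · refine fun x => Filter.Eventually.of_forall fun y => ?_
    rw [norm_mul]
    exact mul_le_mul_of_nonneg_right (by simpa using abs_kernel_le c x y) (norm_nonneg _)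
  · refine Filter.Eventually.of_forall fun y => ?_
    have : Continuous fun x => (kernel c x y : ℂ) :=
      Complex.continuous_ofReal.comp ((continuous_kernel c).comp (by fun_prop : Continuous fun x => (x, y)))
    exact this.mul continuous_const

theorem memLp_integralTransform (c : ℝ) (f : L2) : MemLp (integralTransform c f) 2 vol :=
  MemLp.of_bound (continuous_integralTransform c f).aestronglyMeasurable _
    (Filter.Eventually.of_forall fun x => norm_integralTransform_le c x f)

theorem integral_norm_le (f : L2) :
    ∫ y, ‖f y‖ ∂vol ≤ ‖f‖ * (vol Set.univ ^ ((1 : ℝ) / 2)).toReal := by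
  have hm := (Lp.memLp f).aestronglyMeasurable
  have h := eLpNorm_le_eLpNorm_mul_rpow_measure_univ (p := 1) (q := 2) (by norm_num) hm
  have he : 1 / (1 : ENNReal).toReal - 1 / (2 : ENNReal).toReal = (1 : ℝ) / 2 := by norm_num
  rw [he] at h
  rw [integral_norm_eq_lintegral_enorm hm, ← eLpNorm_one_eq_lintegral_enorm, Lp.norm_def,
    ← ENNReal.toReal_mul]
  refine ENNReal.toReal_mono (ENNReal.mul_ne_top (Lp.eLpNorm_ne_top f) ?_) h
  exact ENNReal.rpow_ne_top_of_nonneg (by norm_num) (measure_ne_top _ _)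

/-- The sinc-kernel operator as a linear map on `L²([-1, 1])`. -/
def operatorLin (c : ℝ) : L2 →ₗ[ℂ] L2 where
  toFun f := (memLp_integralTransform c f).toLp (integralTransform c f)
  map_add' f g := by
    rw [← MemLp.toLp_add]
    refine MemLp.toLp_congr _ _ (Filter.Eventually.of_forall fun x => ?_)
    simp only [Pi.add_apply, integralTransform]
    rw [← integral_add (integrable_kernel_mul c x f) (integrable_kernel_mul c x g)]
    refine integral_congr_ae ?_
    filter_upwards [Lp.coeFn_add f g] with y hy
    rw [hy, Pi.add_apply, mul_add]
  map_smul' a f := by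
    rw [RingHom.id_apply, ← MemLp.toLp_const_smul]
    refine MemLp.toLp_congr _ _ (Filter.Eventually.of_forall fun x => ?_)
    simp only [Pi.smul_apply, integralTransform]
    rw [← integral_smul]
    refine integral_congr_ae ?_
    filter_upwards [Lp.coeFn_smul a f] with y hy
    rw [hy, Pi.smul_apply, smul_eq_mul, smul_eq_mul]
    ring

/-- The time-frequency limiting operator `Q_c` on `L²([-1, 1])`,
`Q_c f (x) = ∫_{-1}^{1} sin (c (x - y)) / (π (x - y)) f(y) dy`, as a bounded operator. -/
def operator (c : ℝ) : L2 →L[ℂ] L2 :=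
  (operatorLin c).mkContinuousOfExistsBound
    ⟨measureUnivNNReal vol ^ (2 : ENNReal).toReal⁻¹ *
        (|c| / Real.pi * (vol Set.univ ^ ((1 : ℝ) / 2)).toReal), fun f => by
      have hn := integral_norm_le f
      have hpi : 0 ≤ |c| / Real.pi := by positivity
      have h := Lp.norm_le_of_ae_bound (f := operatorLin c f)
        (C := |c| / Real.pi * (‖f‖ * (vol Set.univ ^ ((1 : ℝ) / 2)).toReal)) (by positivity) (by
          filter_upwards [MemLp.coeFn_toLp (memLp_integralTransform c f)] with x hx
          refine (le_of_eq (congrArg norm hx)).trans ?_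
          exact (norm_integralTransform_le c x f).trans (mul_le_mul_of_nonneg_left hn hpi))
      refine h.trans (le_of_eq ?_)
      ring⟩

theorem operator_coeFn (c : ℝ) (f : L2) :
    (operator c f : ℝ → ℂ) =ᵐ[vol] integralTransform c f :=
  MemLp.coeFn_toLp (memLp_integralTransform c f)

/-- The linear span of all eigenvectors of `Q_c` with eigenvalue at least `t`; its
dimension is the number of eigenvalues `≥ t`, counted with multiplicity. -/
def spectralSubspace (c t : ℝ) : Submodule ℂ L2 :=
  ⨆ μ : {μ : ℝ // t ≤ μ},
    Module.End.eigenspace (operator c : L2 →ₗ[ℂ] L2) ((μ : ℝ) : ℂ)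

/-- For `c > 0` and `n ≥ 1`, the `n`-th largest eigenvalue `λ_n(c)` of `Q_c`, counted with
multiplicity (so `λ_1(c) ≥ λ_2(c) ≥ …`): the largest `t` such that at least `n` eigenvalues,
counted with multiplicity, are `≥ t`. -/
def eigenvalue (c : ℝ) (n : ℕ) : ℝ :=
  sSup {t : ℝ | (n : Cardinal) ≤ Module.rank ℂ (spectralSubspace c t)}

end Prolate

end

/-!
The proof tests the quadratic form of `Q_c` on step functions. As the sinc kernel is a Fourier
transform, `Q_c = (c / 2π) ∫_{-1}^{1} ⟪e_t, ·⟫ e_t dt` with `e_t(x) = exp (i c t x)`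
(`operator_eq_integral`), so `Q_c` is compact and positive, and
`⟪f, Q_c f⟫ = (c / 2π) ∫ |⟪e_t, f⟫|² dt`. By the min-max principle
(`natCast_le_rank_iSup_eigenspace`), `λ_n(c)` is at least the minimum of this form over the unit
sphere of any `n`-dimensional space. On functions that are constant on `n` equal subintervals, with
coefficients `a_k` in the normalized indicators, the form equals
`(1/π) ∫_{|s| ≤ c/n} sinc² s |∑ a_k e^{2iks}|² ds` (`reApplyInnerSelf_sum_cellVec`). It remains to
bound this integral from below by a multiple of `∑ |a_k|²`.

If `n ≤ 2c/π`, the domain contains a full period, and Parseval's identity together with lower bounds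
for `sinc` is enough (`four_div_le_eigenvalue`).

If `x = 2c/(πn) < 1`, the domain is an arc covering the fraction `x` of the circle, and the
coefficients have to be controlled by values on that arc. With `y = min x (1/2)`, a polynomial of
degree `N = n - 1` is interpolated at `n` equally spaced points of the arc of fraction `y`; the
Lagrange basis is bounded on the whole circle by the separation of the nodes, and Parseval's
identity bounds the coefficients (`sum_norm_sq_le_sum_nodes`). Averaging over the position of the
nodes gives a Turán-type inequality in `L²` (`sum_norm_sq_le_integral_arc`). The resulting constant
`(y/n) (N! (y/n)^N)²` is of order `y (y/e)^{2N}`; the base `x/14` of the claimed bound leaves ample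
room, also for the passage from `x` to `y ≥ x/2` (`power_bound_le_factorial_bound`).
-/

noncomputable section

namespace Prolate

/-! ### A min-max lower bound -/

open Module.End ComplexOrder in
/-- The half of the Courant–Fischer principle that bounds eigenvalues from below, for a compact
positive operator. If the spectral subspace `W` of the eigenvalues `≥ m` had dimension less than
`n`, the span of the `n` orthonormal vectors would contain a nonzero vector orthogonal to `W`. Hence
the restriction of `T` to `Wᗮ` would have norm at least `m`; being compact and positive, it would
have its norm as an eigenvalue, with an eigenvector in `W ∩ Wᗮ`. -/
theorem natCast_le_rank_iSup_eigenspace {E : Type*} [NormedAddCommGroup E] [InnerProductSpace ℂ E]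
    [CompleteSpace E] {T : E →L[ℂ] E} (hT : IsCompactOperator T) (hpos : T.IsPositive)
    {n : ℕ} {u : Fin n → E} (hu : Orthonormal ℂ u) {m : ℝ} (hm : 0 < m)
    (h : ∀ a : Fin n → ℂ, m * ∑ k, ‖a k‖ ^ 2 ≤ T.reApplyInnerSelf (∑ k, a k • u k)) :
    (n : Cardinal) ≤ Module.rank ℂ
      (⨆ μ : {μ : ℝ // m ≤ μ}, eigenspace (T : E →ₗ[ℂ] E) ((μ : ℝ) : ℂ) : Submodule ℂ E) := by
  set W : Submodule ℂ E := ⨆ μ : {μ : ℝ // m ≤ μ}, eigenspace (T : E →ₗ[ℂ] E) ((μ : ℝ) : ℂ)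
  by_contra! hlt
  have : FiniteDimensional ℂ W :=
    Module.rank_lt_aleph0_iff.1 (hlt.trans (Cardinal.natCast_lt_aleph0))
  have hfin : Module.finrank ℂ W < n := by
    rw [← Module.finrank_eq_rank] at hlt
    exact_mod_cast hlt
  have hsymm : (T : E →ₗ[ℂ] E).IsSymmetric := hpos.isSymmetric
  have hinvW : ∀ w ∈ W, T w ∈ W := by
    intro w hw
    have hle : W ≤ W.comap (T : E →ₗ[ℂ] E) := by
      refine iSup_le fun μ v hv => ?_
      rw [Submodule.mem_comap, mem_eigenspace_iff.1 hv]
      exact W.smul_mem _ (Submodule.mem_iSup_of_mem μ hv)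
    exact hle hw
  have hinv : ∀ w ∈ Wᗮ, T w ∈ Wᗮ := by
    intro v hv w hw
    rw [← ContinuousLinearMap.coe_coe, ← hsymm w v]
    exact hv _ (hinvW w hw)
  -- a nonzero combination of the `u k` orthogonal to `W`, by counting dimensions
  obtain ⟨a, ha, ha0⟩ : ∃ a : Fin n → ℂ, (∑ k, a k • u k) ∈ Wᗮ ∧ a ≠ 0 := by
    let Φ : (Fin n → ℂ) →ₗ[ℂ] W :=
      (W.orthogonalProjectionOnto : E →ₗ[ℂ] W) ∘ₗ Fintype.linearCombination ℂ u
    have hker : LinearMap.ker Φ ≠ ⊥ := by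
      apply LinearMap.ker_ne_bot_of_finrank_lt
      simpa using hfin
    obtain ⟨a, ha, ha0⟩ := Submodule.exists_mem_ne_zero_of_ne_bot hker
    refine ⟨a, ?_, ha0⟩
    rw [← Submodule.orthogonalProjectionOnto_eq_zero_iff]
    simpa [Φ, Fintype.linearCombination_apply] using ha
  set f : E := ∑ k, a k • u k with hf
  have hfn : ‖f‖ ^ 2 = ∑ k, ‖a k‖ ^ 2 := by
    have := hu.inner_sum a a Finset.univ
    rw [← hf, inner_self_eq_norm_sq_to_K] at this
    have h2 : ((‖f‖ ^ 2 : ℝ) : ℂ) = ((∑ k, ‖a k‖ ^ 2 : ℝ) : ℂ) := by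
      push_cast
      refine this.trans (Finset.sum_congr rfl fun k _ => ?_)
      exact Complex.conj_mul' (a k)
    exact_mod_cast h2
  have hf0 : f ≠ 0 := by
    intro h0
    apply ha0
    have := Fintype.linearIndependent_iff.1 hu.linearIndependent a (hf.symm.trans h0)
    exact funext this
  -- the restriction of `T` to `Wᗮ`, whose norm is at least `m` because of `f`
  let S : Wᗮ →L[ℂ] Wᗮ := T.restrict hinv
  have hSc : IsCompactOperator S := hT.restrict' hinv
  have hSs : (S : Wᗮ →ₗ[ℂ] Wᗮ).IsSymmetric := hsymm.restrict_invariant hinv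
  have : Nontrivial Wᗮ := ⟨⟨f, ha⟩, 0, fun h => hf0 (congrArg Subtype.val h)⟩
  have hSm : m ≤ ‖S‖ := by
    have h1 : m * ‖f‖ ^ 2 ≤ ‖T f‖ * ‖f‖ := by
      rw [hfn]
      exact (h a).trans (re_inner_le_norm (𝕜 := ℂ) (T f) f)
    have h2 : ‖T f‖ ≤ ‖S‖ * ‖f‖ := S.le_opNorm ⟨f, ha⟩
    have h3 : 0 < ‖f‖ := norm_pos_iff.2 hf0
    nlinarith [mul_le_mul_of_nonneg_right h2 h3.le, pow_pos h3 2]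
  -- a spectral value of modulus `‖S‖`, which is an eigenvalue by compactness
  obtain ⟨k, hk, hkn⟩ := spectrum.exists_nnnorm_eq_spectralRadius S
  rw [S.spectralRadius_eq_nnnorm hSs.isSelfAdjoint, ENNReal.coe_inj] at hkn
  have hkn : ‖k‖ = ‖S‖ := congrArg NNReal.toReal hkn
  have hk0 : k ≠ 0 := by
    rintro rfl
    rw [norm_zero] at hkn
    linarith
  obtain ⟨v, hv⟩ := ((hSc.hasEigenvalue_iff_mem_spectrum hk0).2 hk).exists_hasEigenvector
  have hTv : T (v : E) = k • (v : E) := congrArg Subtype.val (mem_eigenspace_iff.1 hv.1)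
  have hkre : 0 ≤ k.re ∧ (k.re : ℂ) = k := by
    have h0 := hpos.inner_nonneg_right (v : E)
    rw [hTv, inner_smul_right, inner_self_eq_norm_sq_to_K] at h0
    have hr : (0 : ℝ) < ‖(v : E)‖ ^ 2 := pow_pos (norm_pos_iff.2 fun h => hv.2 (Subtype.ext h)) 2
    have h0 : 0 ≤ k * ((‖(v : E)‖ ^ 2 : ℝ) : ℂ) := by simpa using h0
    rw [Complex.nonneg_iff, Complex.re_mul_ofReal, Complex.im_mul_ofReal] at h0
    refine ⟨nonneg_of_mul_nonneg_left h0.1 hr, Complex.ext rfl ?_⟩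
    exact (by simpa [hr.ne'] using h0.2 : k.im = 0).symm
  have hkS : k.re = ‖S‖ := by
    rw [← hkn, ← hkre.2, Complex.norm_real, Real.norm_of_nonneg hkre.1, Complex.ofReal_re]
  have hvW : (v : E) ∈ W := by
    refine Submodule.mem_iSup_of_mem ⟨k.re, by rw [hkS]; exact hSm⟩ (mem_eigenspace_iff.2 ?_)
    rw [hkre.2]
    exact hTv
  exact hv.2 (Subtype.ext (inner_self_eq_zero.1 (v.2 _ hvW)))

theorem spectralSubspace_eq_bot {c t : ℝ} (ht : ‖operator c‖ < t) : spectralSubspace c t = ⊥ := by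
  refine (iSup_eq_bot.2 fun μ => ?_)
  rw [Submodule.eq_bot_iff]
  intro v hv
  have hv : operator c v = ((μ : ℝ) : ℂ) • v := Module.End.mem_eigenspace_iff.1 hv
  have h1 := (operator c).le_opNorm v
  rw [hv, norm_smul, Complex.norm_real] at h1
  by_contra h0
  have h2 := le_of_mul_le_mul_right h1 (norm_pos_iff.2 h0)
  exact absurd (ht.trans_le (μ.2.trans (le_abs_self _))) (not_lt.2 h2)

/-- A lower bound on the dimension of a spectral subspace is a lower bound on `λ_n(c)`. The supremum
defining `λ_n(c)` is a genuine one because no eigenvalue exceeds `‖Q_c‖`. -/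
theorem le_eigenvalue {c t : ℝ} {n : ℕ} (hn : 1 ≤ n)
    (h : (n : Cardinal) ≤ Module.rank ℂ (spectralSubspace c t)) : t ≤ eigenvalue c n := by
  refine le_csSup ⟨‖operator c‖, fun s hs => ?_⟩ h
  by_contra! hlt
  have hs : (n : Cardinal) ≤ Module.rank ℂ (spectralSubspace c s) := hs
  rw [spectralSubspace_eq_bot hlt, rank_bot] at hs
  exact absurd hs (not_le.2 (by exact_mod_cast hn))

/-! ### Fourier representation and compactness of the operator -/

/-- The exponential `x ↦ exp (i c t x)`. -/
def expFun (c t x : ℝ) : ℂ := Complex.exp ((c * t * x : ℝ) * Complex.I)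

theorem norm_expFun (c t x : ℝ) : ‖expFun c t x‖ = 1 := Complex.norm_exp_ofReal_mul_I _

theorem continuous_expFun (c : ℝ) : Continuous fun p : ℝ × ℝ => expFun c p.1 p.2 := by
  unfold expFun
  fun_prop

theorem memLp_expFun (c t : ℝ) : MemLp (expFun c t) 2 vol :=
  MemLp.of_bound ((continuous_expFun c).comp
    (by fun_prop : Continuous fun x => (t, x))).aestronglyMeasurable 1
    (Filter.Eventually.of_forall fun x => (norm_expFun c t x).le)

/-- The exponential `x ↦ exp (i c t x)` as an element of `L²([-1, 1])`. -/
def expVec (c t : ℝ) : L2 := (memLp_expFun c t).toLp (expFun c t)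

theorem continuous_expVec (c : ℝ) : Continuous (expVec c) := by
  have hlip : ∀ s t, ‖expVec c s - expVec c t‖ ≤
      measureUnivNNReal vol ^ (2 : ENNReal).toReal⁻¹ * (|c| * |s - t|) := by
    intro s t
    refine Lp.norm_le_of_ae_bound (by positivity) ?_
    filter_upwards [Lp.coeFn_sub (expVec c s) (expVec c t), MemLp.coeFn_toLp (memLp_expFun c s),
      MemLp.coeFn_toLp (memLp_expFun c t), ae_restrict_mem measurableSet_Icc] with x h1 h2 h3 hx
    have h2 : expVec c s x = expFun c s x := h2
    have h3 : expVec c t x = expFun c t x := h3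
    rw [h1, Pi.sub_apply, h2, h3]
    have hfac : expFun c s x - expFun c t x =
        expFun c t x * (Complex.exp (Complex.I * (c * (s - t) * x : ℝ)) - 1) := by
      unfold expFun
      rw [mul_sub, ← Complex.exp_add, mul_one]
      congr 2
      push_cast
      ring
    rw [hfac, norm_mul, norm_expFun, one_mul]
    refine (Real.norm_exp_I_mul_ofReal_sub_one_le).trans ?_
    rw [norm_mul, norm_mul, Real.norm_eq_abs, Real.norm_eq_abs, Real.norm_eq_abs]
    exact mul_le_of_le_one_right (by positivity) (abs_le.2 hx)
  refine continuous_iff_continuousAt.2 fun t => ?_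
  rw [ContinuousAt, tendsto_iff_norm_sub_tendsto_zero]
  refine squeeze_zero (fun _ => norm_nonneg _) (fun s => hlip s t) ?_
  have : Continuous fun s : ℝ =>
      (measureUnivNNReal vol : ℝ) ^ (2 : ENNReal).toReal⁻¹ * (|c| * |s - t|) := by
    fun_prop
  have h := this.tendsto t
  simpa using h

theorem integral_exp_eq_sinc (r : ℝ) :
    ∫ t, Complex.exp ((r * t : ℝ) * Complex.I) ∂vol = 2 * Real.sinc r := by
  rw [integral_Icc_eq_integral_Ioc, ← intervalIntegral.integral_of_le (by norm_num)]
  rcases eq_or_ne r 0 with rfl | hr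
  · simp; norm_num
  · have h := intervalIntegral.integral_comp_mul_left (a := -1) (b := 1)
      (fun t : ℝ => Complex.exp (t * Complex.I)) hr
    rw [h, mul_neg, mul_one, integral_exp_mul_I_eq_sinc, Complex.real_smul]
    push_cast
    have : (r : ℂ) ≠ 0 := by exact_mod_cast hr
    field_simp

/-- The sinc kernel is the Fourier transform of the indicator of `[-1, 1]`, rescaled: it is a
superposition of the rank-one kernels `exp (i c t x) · exp (-i c t y)`. -/
theorem kernel_eq_integral (c x y : ℝ) :
    (kernel c x y : ℂ) = (c / (2 * Real.pi) : ℝ) * ∫ t, expFun c t (x - y) ∂vol := by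
  have h : (fun t => expFun c t (x - y)) =
      fun t => Complex.exp (((c * (x - y)) * t : ℝ) * Complex.I) := by
    funext t
    unfold expFun
    congr 3
    ring
  rw [h, integral_exp_eq_sinc, kernel_eq_sinc]
  push_cast
  ring

/-- Fubini's theorem for the product of an integrable function of one variable and a bounded
continuous kernel. -/
theorem integral_mul_integral_swap {h : ℝ → ℂ} (hh : Integrable h vol) {K : ℝ → ℝ → ℂ}
    (hK : Continuous fun p : ℝ × ℝ => K p.1 p.2) {C : ℝ} (hC : ∀ x t, ‖K x t‖ ≤ C) :
    ∫ x, h x * ∫ t, K x t ∂vol ∂vol = ∫ t, ∫ x, h x * K x t ∂vol ∂vol := by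
  simp_rw [← integral_const_mul]
  refine integral_integral_swap ?_
  refine Integrable.mul_bdd (c := C) (hh.comp_fst vol) hK.aestronglyMeasurable ?_
  exact Filter.Eventually.of_forall fun p => hC _ _

theorem inner_expVec (c t : ℝ) (f : L2) :
    inner ℂ (expVec c t) f = ∫ y, f y * expFun c t (-y) ∂vol := by
  rw [L2.inner_def]
  refine integral_congr_ae ?_
  filter_upwards [MemLp.coeFn_toLp (memLp_expFun c t)] with y hy
  have hy : expVec c t y = expFun c t y := hy
  rw [hy, RCLike.inner_apply]
  congr 1
  unfold expFun
  rw [← Complex.exp_conj, map_mul, Complex.conj_I, Complex.conj_ofReal]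
  congr 1
  push_cast
  ring

theorem inner_expVec_right (c t : ℝ) (g : L2) :
    inner ℂ g (expVec c t) = ∫ x, starRingEnd ℂ (g x) * expFun c t x ∂vol := by
  rw [L2.inner_def]
  refine integral_congr_ae ?_
  filter_upwards [MemLp.coeFn_toLp (memLp_expFun c t)] with y hy
  have hy : expVec c t y = expFun c t y := hy
  rw [hy, RCLike.inner_apply, mul_comm]

theorem integralTransform_eq (c x : ℝ) (f : L2) :
    integralTransform c f x =
      (c / (2 * Real.pi) : ℝ) * ∫ t, expFun c t x * inner ℂ (expVec c t) f ∂vol := by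
  have h1 : integralTransform c f x =
      (c / (2 * Real.pi) : ℝ) * ∫ y, f y * ∫ t, expFun c t (x - y) ∂vol ∂vol := by
    rw [integralTransform, ← integral_const_mul]
    refine integral_congr_ae (Filter.Eventually.of_forall fun y => ?_)
    simp only [kernel_eq_integral]
    ring
  rw [h1, integral_mul_integral_swap (integrable_coe f)
    (K := fun y t => expFun c t (x - y)) (C := 1)
    ((continuous_expFun c).comp (by fun_prop : Continuous fun p : ℝ × ℝ => (p.2, x - p.1)))
    (fun _ _ => (norm_expFun _ _ _).le)]
  congr 1
  refine integral_congr_ae (Filter.Eventually.of_forall fun t => ?_)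
  simp only [inner_expVec]
  rw [← integral_const_mul]
  refine integral_congr_ae (Filter.Eventually.of_forall fun y => ?_)
  have : expFun c t (x - y) = expFun c t x * expFun c t (-y) := by
    unfold expFun
    rw [← Complex.exp_add]
    congr 1
    push_cast
    ring
  simp only [this]
  ring

/-- The sesquilinear form of `Q_c` in the Fourier picture: `Q_c` is `c / 2π` times the integral over
`t ∈ [-1, 1]` of the rank-one operators `f ↦ ⟪e_t, f⟫ e_t`, where `e_t` is `expVec c t`. -/
theorem inner_operator (c : ℝ) (g f : L2) :
    inner ℂ g (operator c f) = (c / (2 * Real.pi) : ℝ) *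
      ∫ t, inner ℂ g (expVec c t) * inner ℂ (expVec c t) f ∂vol := by
  have hg : Integrable (fun x => starRingEnd ℂ (g x)) vol := by
    have := (integrable_coe g)
    exact (Complex.conjCLE : ℂ →L[ℝ] ℂ).integrable_comp this
  have h1 : inner ℂ g (operator c f) = (c / (2 * Real.pi) : ℝ) *
      ∫ x, starRingEnd ℂ (g x) * ∫ t, expFun c t x * inner ℂ (expVec c t) f ∂vol ∂vol := by
    rw [L2.inner_def, ← integral_const_mul]
    refine integral_congr_ae ?_
    filter_upwards [operator_coeFn c f] with x hx
    rw [hx, RCLike.inner_apply, integralTransform_eq]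
    ring
  obtain ⟨C, hC⟩ : ∃ C, ∀ t, ‖expVec c t‖ ≤ C :=
    ⟨_, fun t => Lp.norm_le_of_ae_bound zero_le_one (by
      filter_upwards [MemLp.coeFn_toLp (memLp_expFun c t)] with x hx
      exact (congrArg norm hx).le.trans (norm_expFun c t x).le)⟩
  rw [h1, integral_mul_integral_swap hg (K := fun x t => expFun c t x * inner ℂ (expVec c t) f)
    (C := C * ‖f‖)]
  · congr 1
    refine integral_congr_ae (Filter.Eventually.of_forall fun t => ?_)
    simp only [inner_expVec_right]
    rw [← integral_mul_const]
    refine integral_congr_ae (Filter.Eventually.of_forall fun x => ?_)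
    simp only
    ring
  · refine ((continuous_expFun c).comp
      (by fun_prop : Continuous fun p : ℝ × ℝ => (p.2, p.1))).mul ?_
    exact ((continuous_expVec c).comp continuous_snd).inner continuous_const
  · intro x t
    rw [norm_mul, norm_expFun, one_mul]
    exact (norm_inner_le_norm _ _).trans (mul_le_mul_of_nonneg_right (hC t) (norm_nonneg _))

theorem inner_self_operator (c : ℝ) (f : L2) :
    inner ℂ f (operator c f) =
      ((c / (2 * Real.pi) * ∫ t, ‖inner ℂ (expVec c t) f‖ ^ 2 ∂vol : ℝ) : ℂ) := by
  rw [inner_operator, Complex.ofReal_mul, ← integral_complex_ofReal]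
  congr 1
  refine integral_congr_ae (Filter.Eventually.of_forall fun t => ?_)
  simp only
  rw [← inner_conj_symm, Complex.conj_mul']
  push_cast
  rfl

theorem operator_isPositive {c : ℝ} (hc : 0 ≤ c) : (operator c).IsPositive := by
  rw [ContinuousLinearMap.isPositive_iff_complex]
  intro f
  have h : inner ℂ (operator c f) f =
      ((c / (2 * Real.pi) * ∫ t, ‖inner ℂ (expVec c t) f‖ ^ 2 ∂vol : ℝ) : ℂ) := by
    rw [← inner_conj_symm, inner_self_operator, Complex.conj_ofReal]
  rw [h]
  refine ⟨rfl, ?_⟩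
  have hpi := Real.pi_pos
  simp only [RCLike.re_to_complex, Complex.ofReal_re]
  exact mul_nonneg (by positivity) (integral_nonneg fun t => by positivity)

theorem continuous_rankOne_expVec (c : ℝ) :
    Continuous fun t => InnerProductSpace.rankOne ℂ (expVec c t) (expVec c t) := by
  have h := continuous_expVec c
  exact ((ContinuousLinearMap.smulRightL ℂ L2 L2).continuous.comp
    ((innerSL ℂ (E := L2)).continuous.comp h)).clm_apply h

theorem integrable_rankOne_expVec (c : ℝ) :
    Integrable (fun t => InnerProductSpace.rankOne ℂ (expVec c t) (expVec c t)) vol :=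
  (continuous_rankOne_expVec c).continuousOn.integrableOn_Icc

/-- The formula of `inner_operator` as an identity of operators, with a Bochner integral in operator
norm. -/
theorem operator_eq_integral (c : ℝ) :
    operator c = (c / (2 * Real.pi) : ℝ) •
      ∫ t, InnerProductSpace.rankOne ℂ (expVec c t) (expVec c t) ∂vol := by
  ext1 f
  refine ext_inner_left ℂ fun g => ?_
  rw [inner_operator, smul_apply,
    ContinuousLinearMap.integral_apply (integrable_rankOne_expVec c), inner_smul_right_eq_smul,
    ← integral_inner ((integrable_rankOne_expVec c).apply_continuousLinearMap f),
    Complex.real_smul]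
  congr 1
  refine integral_congr_ae (Filter.Eventually.of_forall fun t => ?_)
  simp [inner_smul_right, mul_comm]

/-- `Q_c` is a multiple of an average of rank-one operators, and the compact operators form a closed
convex set. -/
theorem operator_isCompactOperator (c : ℝ) : IsCompactOperator (operator c) := by
  have hne : NeZero (vol : Measure ℝ) := ⟨by
    intro h
    have := congrArg (fun μ => μ Set.univ) h
    norm_num at this⟩
  have hmem : (⨍ t, InnerProductSpace.rankOne ℂ (expVec c t) (expVec c t) ∂vol) ∈
      {T : L2 →L[ℂ] L2 | IsCompactOperator T} := by
    refine Convex.average_mem ?_ isClosed_setOfPred_isCompactOperator ?_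
      (integrable_rankOne_expVec c)
    · exact ((compactOperator (RingHom.id ℂ) L2 L2).restrictScalars ℝ).convex
    · refine Filter.Eventually.of_forall fun t => ?_
      have h : IsCompactOperator (ContinuousLinearMap.toSpanSingleton ℂ (expVec c t)) :=
        isCompactOperator_of_locallyCompactSpace_rng
          (ContinuousLinearMap.toSpanSingleton ℂ (expVec c t))
      exact h.comp_clm (innerSL ℂ (expVec c t))
  rw [operator_eq_integral, ← measure_smul_average]
  exact ((compactOperator (RingHom.id ℂ) L2 L2).restrictScalars ℝ).smul_mem _
    (((compactOperator (RingHom.id ℂ) L2 L2).restrictScalars ℝ).smul_mem _ hmem)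

/-! ### The quadratic form on step functions -/

/-- The trigonometric polynomial `s ↦ ∑ a_k exp (2 i k s)` with `n` terms; it has period `π`. -/
def trigPoly {n : ℕ} (a : Fin n → ℂ) (s : ℝ) : ℂ :=
  ∑ k, a k * Complex.exp ((2 * k * s : ℝ) * Complex.I)

theorem continuous_trigPoly {n : ℕ} (a : Fin n → ℂ) : Continuous (trigPoly a) := by
  unfold trigPoly
  fun_prop

theorem intervalIntegral_exp (w m h : ℝ) :
    ∫ y in (m - h)..(m + h), Complex.exp ((w * y : ℝ) * Complex.I) =
      2 * h * Real.sinc (w * h) * Complex.exp ((w * m : ℝ) * Complex.I) := by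
  have h1 := intervalIntegral.smul_integral_comp_mul_add (a := -1) (b := 1)
    (fun y : ℝ => Complex.exp ((w * y : ℝ) * Complex.I)) h m
  have h2 : ∀ x : ℝ, Complex.exp ((w * (h * x + m) : ℝ) * Complex.I) =
      Complex.exp (((w * h) * x : ℝ) * Complex.I) * Complex.exp ((w * m : ℝ) * Complex.I) := by
    intro x
    rw [← Complex.exp_add]
    congr 1
    push_cast
    ring
  have h3 := integral_exp_eq_sinc (w * h)
  rw [integral_Icc_eq_integral_Ioc, ← intervalIntegral.integral_of_le (by norm_num)] at h3
  simp only [h2] at h1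
  rw [intervalIntegral.integral_mul_const, h3] at h1
  rw [show m - h = h * (-1) + m by ring, show m + h = h * 1 + m by ring, ← h1, Complex.real_smul]
  ring

/-- The `k`-th of the `n` half-open intervals of length `2 / n` that partition `(-1, 1]`. -/
def cell (n k : ℕ) : Set ℝ := Set.Ioc (-1 + 2 * k / n) (-1 + 2 * (k + 1) / n)

theorem measurableSet_cell (n k : ℕ) : MeasurableSet (cell n k) := measurableSet_Ioc

theorem cell_subset {n k : ℕ} (hk : k < n) : cell n k ⊆ Set.Icc (-1) 1 := by
  have hn : (0 : ℝ) < n := by exact_mod_cast (Nat.zero_le k).trans_lt hk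
  have hk' : (k : ℝ) + 1 ≤ n := by exact_mod_cast hk
  refine Set.Ioc_subset_Icc_self.trans (Set.Icc_subset_Icc ?_ ?_)
  · have : (0 : ℝ) ≤ 2 * k / n := by positivity
    linarith
  · have : 2 * ((k : ℝ) + 1) / n ≤ 2 := by rw [div_le_iff₀ hn]; linarith
    linarith

theorem disjoint_cell {n j k : ℕ} (h : j ≠ k) : Disjoint (cell n j) (cell n k) := by
  wlog hjk : j < k generalizing j k
  · exact (this h.symm (by omega)).symm
  have hjk' : (j : ℝ) + 1 ≤ k := by exact_mod_cast hjk
  have h2 : 2 * ((j : ℝ) + 1) / n ≤ 2 * k / n := by gcongr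
  refine Set.disjoint_left.2 fun x hx hx' => ?_
  have h3 := hx.2
  have h4 := hx'.1
  linarith

theorem restrict_cell {n k : ℕ} (hk : k < n) :
    vol.restrict (cell n k) = volume.restrict (cell n k) := by
  rw [Measure.restrict_restrict (measurableSet_cell n k),
    Set.inter_eq_left.2 (cell_subset hk)]

theorem measureReal_cell {n k : ℕ} (hk : k < n) : vol.real (cell n k) = 2 / n := by
  have h1 : vol.real (cell n k) = volume.real (cell n k) := by
    rw [measureReal_def, measureReal_def, Measure.restrict_apply (measurableSet_cell n k),
      Set.inter_eq_left.2 (cell_subset hk)]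
  have h2 : 2 * (k : ℝ) / n ≤ 2 * (k + 1) / n := by gcongr; linarith
  rw [h1, cell, Real.volume_real_Ioc_of_le (by linarith)]
  ring

/-- The indicator of the `k`-th cell, normalized in `L²([-1, 1])`. -/
def cellVec (n k : ℕ) : L2 :=
  (√(n / 2) : ℂ) • indicatorConstLp 2 (measurableSet_cell n k) (measure_ne_top vol _) (1 : ℂ)

theorem orthonormal_cellVec (n : ℕ) : Orthonormal ℂ fun k : Fin n => cellVec n k := by
  rw [orthonormal_iff_ite]
  intro j k
  have hn : (0 : ℝ) < n := by exact_mod_cast (Nat.zero_le _).trans_lt j.2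
  simp only [cellVec]
  rw [inner_smul_left, inner_smul_right, L2.inner_indicatorConstLp_one_indicatorConstLp_one,
    Complex.conj_ofReal, ← mul_assoc, ← Complex.ofReal_mul, Real.mul_self_sqrt (by positivity)]
  split_ifs with h
  · subst h
    rw [Set.inter_self, measureReal_cell j.2]
    have : (n : ℂ) ≠ 0 := by exact_mod_cast hn.ne'
    push_cast
    field_simp
  · rw [(disjoint_cell (fun h' => h (Fin.ext h'))).inter_eq]
    simp

/-- The Fourier transform of a step function is a trigonometric polynomial times a sinc factor, the
latter being the Fourier transform of a single cell. -/
theorem norm_inner_expVec_sum_cellVec (c t : ℝ) {n : ℕ} (a : Fin n → ℂ) :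
    ‖inner ℂ (expVec c t) (∑ k, a k • cellVec n k)‖ ^ 2 =
      2 / n * (Real.sinc (-(c / n) * t) ^ 2 * ‖trigPoly a (-(c / n) * t)‖ ^ 2) := by
  rcases Nat.eq_zero_or_pos n with rfl | hn
  · simp
  have hn' : (0 : ℝ) < n := by exact_mod_cast hn
  have hcell : ∀ k : Fin n, inner ℂ (expVec c t) (cellVec n k) =
      ((√(n / 2) * (2 / n) * Real.sinc (-(c / n) * t) : ℝ) : ℂ) *
        Complex.exp ((-(c / n) * t * (1 - n) : ℝ) * Complex.I) *
        Complex.exp ((2 * k * (-(c / n) * t) : ℝ) * Complex.I) := by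
    intro k
    have h1 : ∫ y in cell n k, expVec c t y ∂vol =
        2 * (1 / n : ℝ) * Real.sinc (c * t * (1 / n)) *
          Complex.exp ((c * t * (-1 + (2 * k + 1) / n) : ℝ) * Complex.I) := by
      rw [← intervalIntegral_exp, intervalIntegral.integral_of_le
        (by have : 0 < 1 / (n : ℝ) := by positivity
            linarith)]
      have hset : Set.Ioc (-1 + (2 * (k : ℝ) + 1) / n - 1 / n) (-1 + (2 * k + 1) / n + 1 / n)
          = cell n k := by
        unfold cell
        congr 1 <;> ring
      rw [hset, ← restrict_cell k.2]
      refine integral_congr_ae (ae_restrict_of_ae ?_)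
      exact MemLp.coeFn_toLp (memLp_expFun c t)
    rw [cellVec, inner_smul_right, ← inner_conj_symm, L2.inner_indicatorConstLp_one, h1]
    have h2 : Real.sinc (c * t * (1 / n)) = Real.sinc (-(c / n) * t) := by
      rw [← Real.sinc_neg]
      congr 1
      ring
    rw [h2, mul_assoc _ (Complex.exp _) (Complex.exp _), ← Complex.exp_add]
    simp only [map_mul, ← Complex.exp_conj, Complex.conj_I, Complex.conj_ofReal, map_ofNat]
    -- the midpoint of the `k`-th cell is `((1 - n) + 2 k) / n`
    have h3 : ((c * t * (-1 + (2 * k + 1) / n) : ℝ) : ℂ) * -Complex.I =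
        (-(c / n) * t * (1 - n) : ℝ) * Complex.I + (2 * k * (-(c / n) * t) : ℝ) * Complex.I := by
      have : (n : ℂ) ≠ 0 := by exact_mod_cast hn'.ne'
      push_cast
      field_simp
      ring
    rw [h3]
    push_cast
    ring
  have hsum : inner ℂ (expVec c t) (∑ k, a k • cellVec n k) =
      ((√(n / 2) * (2 / n) * Real.sinc (-(c / n) * t) : ℝ) : ℂ) *
        Complex.exp ((-(c / n) * t * (1 - n) : ℝ) * Complex.I) * trigPoly a (-(c / n) * t) := by
    rw [inner_sum, trigPoly, Finset.mul_sum]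
    refine Finset.sum_congr rfl fun k _ => ?_
    rw [inner_smul_right, hcell]
    ring
  rw [hsum, norm_mul, norm_mul, Complex.norm_exp_ofReal_mul_I, mul_one, Complex.norm_real,
    Real.norm_eq_abs, mul_pow, sq_abs, mul_pow, mul_pow, Real.sq_sqrt (by positivity)]
  field_simp

/-- The quadratic form of `Q_c` on step functions. -/
theorem reApplyInnerSelf_sum_cellVec {c : ℝ} (hc : 0 < c) {n : ℕ} (hn : 1 ≤ n) (a : Fin n → ℂ) :
    (operator c).reApplyInnerSelf (∑ k : Fin n, a k • cellVec n k) =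
      1 / Real.pi * ∫ s in -(c / n)..(c / n), Real.sinc s ^ 2 * ‖trigPoly a s‖ ^ 2 := by
  have hn' : (0 : ℝ) < n := by exact_mod_cast hn
  rw [ContinuousLinearMap.reApplyInnerSelf_apply, ← inner_conj_symm, inner_self_operator,
    Complex.conj_ofReal]
  simp only [RCLike.re_to_complex, Complex.ofReal_re, norm_inner_expVec_sum_cellVec]
  rw [integral_const_mul, integral_Icc_eq_integral_Ioc,
    ← intervalIntegral.integral_of_le (by norm_num),
    intervalIntegral.integral_comp_mul_left
      (fun s => Real.sinc s ^ 2 * ‖trigPoly a s‖ ^ 2) (neg_ne_zero.2 (by positivity)),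
    intervalIntegral.integral_symm, smul_eq_mul]
  have hpi := Real.pi_ne_zero
  rw [mul_one, mul_neg_one, neg_neg]
  field_simp

/-- The reduction of a lower bound on `λ_n(c)` to an inequality for trigonometric polynomials with
`n` terms on a symmetric arc, which may be smaller than the arc `|s| ≤ c / n` given by `Q_c`. -/
theorem le_eigenvalue_of_le_integral {c : ℝ} (hc : 0 < c) {n : ℕ} (hn : 1 ≤ n) {m β : ℝ}
    (hm : 0 < m) (hβ : 0 ≤ β) (hβc : β ≤ c / n)
    (h : ∀ a : Fin n → ℂ, m * ∑ k, ‖a k‖ ^ 2 ≤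
      1 / Real.pi * ∫ s in -β..β, Real.sinc s ^ 2 * ‖trigPoly a s‖ ^ 2) :
    m ≤ eigenvalue c n := by
  refine le_eigenvalue hn (natCast_le_rank_iSup_eigenspace (operator_isCompactOperator c)
    (operator_isPositive hc.le) (orthonormal_cellVec n) hm fun a => ?_)
  rw [reApplyInnerSelf_sum_cellVec hc hn]
  refine (h a).trans (mul_le_mul_of_nonneg_left ?_ (by positivity))
  have hcont : Continuous fun s => Real.sinc s ^ 2 * ‖trigPoly a s‖ ^ 2 :=
    (Real.continuous_sinc.pow 2).mul ((continuous_trigPoly a).norm.pow 2)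
  refine intervalIntegral.integral_mono_interval (by linarith) (by linarith) hβc ?_
    (hcont.intervalIntegrable _ _)
  exact Filter.Eventually.of_forall fun s => by positivity

/-! ### Lower bounds for sinc and Parseval's identity -/

theorem one_sub_sq_div_six_le_sinc (s : ℝ) : 1 - s ^ 2 / 6 ≤ Real.sinc s := by
  wlog hs : 0 ≤ s generalizing s
  · simpa using this (-s) (by linarith)
  rcases hs.eq_or_lt with rfl | hs
  · simp
  · rw [Real.sinc_of_ne_zero hs.ne', le_div_iff₀ hs]
    have := Real.sin_ge_sub_cube hs.le
    linarith

theorem two_div_pi_le_sinc {s : ℝ} (hs : |s| ≤ Real.pi / 2) : 2 / Real.pi ≤ Real.sinc s := by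
  wlog h0 : 0 ≤ s generalizing s
  · simpa using this (s := -s) (by rwa [abs_neg]) (by linarith)
  rcases h0.eq_or_lt with rfl | h0
  · rw [Real.sinc_zero, div_le_one Real.pi_pos]
    exact Real.two_le_pi
  · rw [Real.sinc_of_ne_zero h0.ne', le_div_iff₀ h0]
    exact Real.mul_le_sin h0.le (le_of_abs_le hs)

/-- Parseval's identity over one period. -/
theorem integral_norm_trigPoly_sq {n : ℕ} (a : Fin n → ℂ) :
    ∫ s in -(Real.pi / 2)..(Real.pi / 2), ‖trigPoly a s‖ ^ 2 = Real.pi * ∑ k, ‖a k‖ ^ 2 := by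
  have hexp : ∀ s : ℝ, ((‖trigPoly a s‖ ^ 2 : ℝ) : ℂ) = ∑ j, ∑ k,
      starRingEnd ℂ (a j) * a k *
        Complex.exp ((2 * ((k : ℕ) - (j : ℕ) : ℝ) * s : ℝ) * Complex.I) := by
    intro s
    rw [Complex.ofReal_pow, ← Complex.conj_mul', trigPoly, map_sum, Finset.sum_mul_sum]
    refine Finset.sum_congr rfl fun j _ => Finset.sum_congr rfl fun k _ => ?_
    rw [map_mul, ← Complex.exp_conj, map_mul, Complex.conj_I, Complex.conj_ofReal,
      mul_mul_mul_comm, ← Complex.exp_add]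
    congr 2
    push_cast
    ring
  have hint : ∀ j k : Fin n, ∫ s in -(Real.pi / 2)..(Real.pi / 2),
      Complex.exp ((2 * ((k : ℕ) - (j : ℕ) : ℝ) * s : ℝ) * Complex.I) =
        if j = k then (Real.pi : ℂ) else 0 := by
    intro j k
    have h := intervalIntegral_exp (2 * ((k : ℕ) - (j : ℕ) : ℝ)) 0 (Real.pi / 2)
    rw [zero_sub, zero_add] at h
    rw [h]
    split_ifs with hjk
    · subst hjk
      simp
      ring
    · have h1 : (2 * ((k : ℕ) - (j : ℕ) : ℝ) * (Real.pi / 2)) =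
          (((k : ℕ) - (j : ℕ) : ℤ) : ℝ) * Real.pi := by
        push_cast
        ring
      have h2 : (((k : ℕ) - (j : ℕ) : ℤ) : ℝ) * Real.pi ≠ 0 := by
        refine mul_ne_zero ?_ Real.pi_ne_zero
        have : (k : ℕ) ≠ j := fun h => hjk (Fin.ext h.symm)
        exact_mod_cast (by omega : ((k : ℕ) - (j : ℕ) : ℤ) ≠ 0)
      rw [h1, Real.sinc_of_ne_zero h2, Real.sin_int_mul_pi]
      simp
  apply Complex.ofReal_injective
  rw [← intervalIntegral.integral_ofReal]
  simp only [hexp]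
  rw [intervalIntegral.integral_finsetSum
    fun j _ => Continuous.intervalIntegrable (by fun_prop) _ _]
  have : ∀ j, ∫ s in -(Real.pi / 2)..(Real.pi / 2), ∑ k, starRingEnd ℂ (a j) * a k *
        Complex.exp ((2 * ((k : ℕ) - (j : ℕ) : ℝ) * s : ℝ) * Complex.I) =
        Real.pi * (‖a j‖ : ℂ) ^ 2 := by
    intro j
    rw [intervalIntegral.integral_finsetSum
      fun j _ => Continuous.intervalIntegrable (by fun_prop) _ _]
    simp only [intervalIntegral.integral_const_mul, hint, mul_ite, mul_zero,
      Finset.sum_ite_eq, Finset.mem_univ, if_true, Complex.conj_mul']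
    ring
  simp only [this, ← Finset.mul_sum]
  push_cast
  rfl

theorem integral_one_sub_sq_mul (A B C : ℝ) :
    ∫ s in -(Real.pi / 2)..(Real.pi / 2),
      (1 - s ^ 2 / 3) * (A + B * Real.cos (2 * s) + C * Real.sin (2 * s)) =
      Real.pi * (A * (1 - Real.pi ^ 2 / 36) + B / 6) := by
  have hder : ∀ s : ℝ, HasDerivAt (fun s : ℝ => A * (s - s ^ 3 / 9)
      + B * ((1 / 2 + 1 / 12 - s ^ 2 / 6) * Real.sin (2 * s) - s / 6 * Real.cos (2 * s))
      + C * ((s ^ 2 / 6 - 1 / 2 - 1 / 12) * Real.cos (2 * s) - s / 6 * Real.sin (2 * s)))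
      ((1 - s ^ 2 / 3) * (A + B * Real.cos (2 * s) + C * Real.sin (2 * s))) s := by
    intro s
    have h1 : HasDerivAt (fun s : ℝ => 2 * s) 2 s := by
      simpa using (hasDerivAt_id s).const_mul 2
    have hs := h1.sin
    have hc := h1.cos
    have hid := hasDerivAt_id' s
    have h2 := hasDerivAt_pow 2 s
    have h3 := hasDerivAt_pow 3 s
    have hA := (hid.sub (h3.div_const 9)).const_mul A
    have hB := ((((h2.div_const 6).const_sub (1 / 2 + 1 / 12)).mul hs).sub
      ((hid.div_const 6).mul hc)).const_mul B
    have hC := (((((h2.div_const 6).sub_const (1 / 2)).sub_const (1 / 12)).mul hc).sub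
      ((hid.div_const 6).mul hs)).const_mul C
    refine ((hA.add hB).add hC).congr_deriv ?_
    push_cast
    ring
  rw [intervalIntegral.integral_eq_sub_of_hasDerivAt (fun s _ => hder s)
    (Continuous.intervalIntegrable (by fun_prop) _ _)]
  have e1 : 2 * (Real.pi / 2) = Real.pi := by ring
  have e2 : 2 * -(Real.pi / 2) = -Real.pi := by ring
  simp only [e1, e2, Real.sin_neg, Real.cos_neg, Real.sin_pi, Real.cos_pi]
  ring

theorem integral_mul_mono {F G : ℝ → ℝ} (hF : Continuous F) (hG : Continuous G) {β : ℝ}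
    (hβ : 0 ≤ β) {g : ℝ → ℝ} (hg : Continuous g) (hg0 : ∀ s, 0 ≤ g s)
    (hFG : ∀ s, |s| ≤ β → F s ≤ G s) :
    ∫ s in -β..β, F s * g s ≤ ∫ s in -β..β, G s * g s := by
  refine intervalIntegral.integral_mono_on (by linarith) ((hF.mul hg).intervalIntegrable _ _)
    ((hG.mul hg).intervalIntegrable _ _) fun s hs => ?_
  exact mul_le_mul_of_nonneg_right (hFG s (abs_le.2 hs)) (hg0 s)

theorem one_sub_sq_div_three_le_sinc_sq {s : ℝ} (hs : |s| ≤ Real.pi / 2) :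
    1 - s ^ 2 / 3 ≤ Real.sinc s ^ 2 := by
  have h1 := one_sub_sq_div_six_le_sinc s
  have h2 : |s| ≤ 2 := hs.trans (by linarith [Real.pi_le_four])
  have h3 : s ^ 2 ≤ 2 ^ 2 := sq_le_sq' (abs_le.1 h2).1 (abs_le.1 h2).2
  have h4 := pow_le_pow_left₀ (by linarith : 0 ≤ 1 - s ^ 2 / 6) h1 2
  nlinarith [sq_nonneg (s ^ 2)]

/-! ### The case `n ≤ 2c/π` -/

/-- The bound when `n ≤ 2c/π`. The arc `|s| ≤ c / n` then contains a full period, so Parseval's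
identity applies. For `n ≥ 3` the estimate `sinc ≥ 2/π` gives `λ_n(c) ≥ 4/π²`, which suffices; for
`n = 1` and `n = 2` it is too weak and is replaced by `sinc² s ≥ 1 - s²/3`. -/
theorem four_div_le_eigenvalue {c : ℝ} (hc : 0 < c) {n : ℕ} (hn : 1 ≤ n)
    (h : Real.pi * n ≤ 2 * c) : 4 / (Real.pi + 2 * c) ≤ eigenvalue c n := by
  have hpi := Real.pi_pos
  have hpi3 := Real.pi_gt_three
  have hpi4 : Real.pi < 3.15 := Real.pi_lt_d2
  have hn' : (0 : ℝ) < n := by exact_mod_cast hn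
  have hm : 4 / (Real.pi + 2 * c) ≤ 4 / (Real.pi * (n + 1)) := by
    refine div_le_div_of_nonneg_left (by norm_num) (by positivity) (by linarith)
  refine hm.trans (le_eigenvalue_of_le_integral hc hn (β := Real.pi / 2) (by positivity)
    (by positivity) (by rw [le_div_iff₀ hn']; linarith) fun a => ?_)
  have hcont : Continuous fun s => ‖trigPoly a s‖ ^ 2 := (continuous_trigPoly a).norm.pow 2
  have hsinc : Continuous fun s => Real.sinc s ^ 2 := Real.continuous_sinc.pow 2
  have hquad := integral_mul_mono (F := fun s => 1 - s ^ 2 / 3) (by fun_prop) hsinc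
    (β := Real.pi / 2) (by positivity) hcont (fun s => by positivity)
    fun s hs => one_sub_sq_div_three_le_sinc_sq hs
  rw [one_div, ← div_eq_inv_mul, le_div_iff₀ hpi]
  rcases (by omega : n = 1 ∨ n = 2 ∨ 3 ≤ n) with rfl | rfl | hn3
  · refine le_trans ?_ hquad
    have hp : ∀ s, ‖trigPoly a s‖ ^ 2 =
        ‖a 0‖ ^ 2 + 0 * Real.cos (2 * s) + 0 * Real.sin (2 * s) := by
      intro s
      simp [trigPoly]
    simp only [hp]
    rw [integral_one_sub_sq_mul, Fin.sum_univ_one]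
    have h1 : 4 / (Real.pi * ((1 : ℕ) + 1)) ≤ 1 - Real.pi ^ 2 / 36 := by
      rw [div_le_iff₀ (by positivity)]
      push_cast
      nlinarith
    nlinarith [mul_le_mul_of_nonneg_right h1 (by positivity : 0 ≤ Real.pi * ‖a 0‖ ^ 2)]
  · refine le_trans ?_ hquad
    -- `conj (a 0) * a 1 = u + i v`, so that `|a 0 + a 1 e^{2is}|²` is explicit in `cos`, `sin`
    set u := (a 0).re * (a 1).re + (a 0).im * (a 1).im with hu
    set v := (a 0).re * (a 1).im - (a 0).im * (a 1).re with hv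
    have hp : ∀ s, ‖trigPoly a s‖ ^ 2 = (‖a 0‖ ^ 2 + ‖a 1‖ ^ 2) + (2 * u) * Real.cos (2 * s)
        + (-2 * v) * Real.sin (2 * s) := by
      intro s
      have : trigPoly a s = a 0 + a 1 * Complex.exp ((2 * s : ℝ) * Complex.I) := by
        simp [trigPoly]
      rw [this, Complex.exp_mul_I, ← Complex.ofReal_cos, ← Complex.ofReal_sin]
      simp only [Complex.sq_norm, Complex.normSq_apply, Complex.add_re, Complex.add_im,
        Complex.mul_re, Complex.mul_im, Complex.ofReal_re, Complex.ofReal_im, Complex.I_re,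
        Complex.I_im, hu, hv]
      linear_combination ((a 1).re ^ 2 + (a 1).im ^ 2) * Real.sin_sq_add_cos_sq (2 * s)
    simp only [hp]
    rw [integral_one_sub_sq_mul, Fin.sum_univ_two]
    have h2 : -(‖a 0‖ ^ 2 + ‖a 1‖ ^ 2) ≤ 2 * u := by
      simp only [Complex.sq_norm, Complex.normSq_apply, hu]
      nlinarith [sq_nonneg ((a 0).re + (a 1).re), sq_nonneg ((a 0).im + (a 1).im)]
    have h1 : 4 / (Real.pi * ((2 : ℕ) + 1)) ≤ 1 - Real.pi ^ 2 / 36 - 1 / 6 := by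
      rw [div_le_iff₀ (by positivity)]
      push_cast
      nlinarith
    have h3 := mul_le_mul_of_nonneg_right h1
      (by positivity : 0 ≤ Real.pi * (‖a 0‖ ^ 2 + ‖a 1‖ ^ 2))
    nlinarith [mul_le_mul_of_nonneg_left h2 hpi.le]
  · have hconst := integral_mul_mono (F := fun _ => (2 / Real.pi) ^ 2) continuous_const hsinc
      (β := Real.pi / 2) (by positivity) hcont (fun s => by positivity)
      fun s hs => pow_le_pow_left₀ (by positivity) (two_div_pi_le_sinc hs) 2
    refine le_trans ?_ hconst
    rw [intervalIntegral.integral_const_mul, integral_norm_trigPoly_sq]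
    have hn3' : (3 : ℝ) ≤ n := by exact_mod_cast hn3
    have h1 : 4 / (Real.pi * (n + 1)) ≤ (2 / Real.pi) ^ 2 := by
      rw [div_pow, div_le_div_iff₀ (by positivity) (by positivity)]
      nlinarith
    have h2 := mul_le_mul_of_nonneg_right h1
      (by positivity : 0 ≤ Real.pi * ∑ k, ‖a k‖ ^ 2)
    linarith

/-! ### Two facts on factorials -/

/-- The product of the distances from an integer point `j` to the other points of
`{0, …, j + i}`. -/
theorem prod_erase_range_abs_sub (i j : ℕ) :
    ∏ m ∈ (Finset.range (j + 1 + i)).erase j, |(j : ℝ) - m| = j.factorial * i.factorial := by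
  induction i with
  | zero =>
    have h1 : (Finset.range (j + 1 + 0)).erase j = Finset.range j := by
      ext m
      simp only [Finset.mem_erase, Finset.mem_range]
      omega
    rw [h1, ← Finset.prod_range_reflect, Nat.factorial_zero, Nat.cast_one, mul_one,
      ← Finset.prod_range_add_one_eq_factorial, Nat.cast_prod]
    refine Finset.prod_congr rfl fun m hm => ?_
    have hm : m < j := Finset.mem_range.1 hm
    rw [Nat.sub_sub, Nat.cast_sub (by omega)]
    push_cast
    rw [abs_of_nonneg (by linarith [(Nat.cast_nonneg m : (0 : ℝ) ≤ m)])]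
    ring
  | succ i ih =>
    have h1 : (Finset.range (j + 1 + (i + 1))).erase j =
        insert (j + 1 + i) ((Finset.range (j + 1 + i)).erase j) := by
      ext m
      simp only [Finset.mem_erase, Finset.mem_insert, Finset.mem_range]
      omega
    rw [h1, Finset.prod_insert (by simp), ih, Nat.factorial_succ]
    push_cast
    rw [abs_of_nonpos (by linarith [(Nat.cast_nonneg i : (0 : ℝ) ≤ i)])]
    ring

/-- The only arithmetic input for the power bound, with `N = n - 1`: it follows from
`(N + 1)^N ≤ 3^N N!` and `N + 1 ≤ 5^N`, as `9 · 5 ≤ 49`. -/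
theorem mul_pow_le_mul_factorial_sq (N : ℕ) :
    ((N : ℝ) + 1) * ((N + 1) ^ N) ^ 2 ≤ 49 ^ N * (N.factorial : ℝ) ^ 2 := by
  have h1 : ((N : ℝ) + 1) ^ N ≤ 3 ^ N * N.factorial := by
    induction N with
    | zero => simp
    | succ N ih =>
      -- the ratio of consecutive powers is at most `e < 3`
      have hexp : (1 + 1 / ((N : ℝ) + 1)) ^ (N + 1) ≤ 3 := by
        have h2 := Real.add_one_le_exp (1 / ((N : ℝ) + 1))
        have h3 := pow_le_pow_left₀ (by positivity) h2 (N + 1)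
        rw [← Real.exp_nat_mul] at h3
        have h4 : ((N + 1 : ℕ) : ℝ) * (1 / ((N : ℝ) + 1)) = 1 := by
          push_cast
          field_simp
        rw [h4] at h3
        rw [add_comm 1]
        exact h3.trans Real.exp_one_lt_three.le
      have h5 : (((N + 1 : ℕ) : ℝ) + 1) = (1 + 1 / ((N : ℝ) + 1)) * (N + 1) := by
        push_cast
        field_simp
      rw [h5, mul_pow, Nat.factorial_succ]
      push_cast
      calc (1 + 1 / ((N : ℝ) + 1)) ^ (N + 1) * ((N : ℝ) + 1) ^ (N + 1)
          ≤ 3 * (((N : ℝ) + 1) ^ N * (N + 1)) := by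
            rw [pow_succ ((N : ℝ) + 1)]
            exact mul_le_mul_of_nonneg_right hexp (by positivity)
        _ ≤ 3 * (3 ^ N * N.factorial * (N + 1)) := by gcongr
        _ = 3 ^ (N + 1) * ((N + 1) * N.factorial) := by ring
  have h2 : (N : ℝ) + 1 ≤ 5 ^ N := by
    have := one_add_mul_le_pow (by norm_num : (-2 : ℝ) ≤ 4) N
    norm_num at this
    linarith [(Nat.cast_nonneg N : (0 : ℝ) ≤ N)]
  calc ((N : ℝ) + 1) * ((N + 1) ^ N) ^ 2 ≤ 5 ^ N * (3 ^ N * N.factorial) ^ 2 := by gcongr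
    _ = 45 ^ N * (N.factorial : ℝ) ^ 2 := by
      rw [mul_pow, ← pow_mul, mul_comm N 2, pow_mul, ← mul_assoc, ← mul_pow]
      norm_num
    _ ≤ 49 ^ N * (N.factorial : ℝ) ^ 2 := by gcongr; norm_num

/-! ### A Turán-type inequality on arcs -/

/-- The point `exp (2 i s)` of the unit circle, at which a polynomial takes the value of the
associated trigonometric polynomial at `s`. -/
def unitPoint (s : ℝ) : ℂ := Complex.exp ((2 * s : ℝ) * Complex.I)

theorem norm_unitPoint (s : ℝ) : ‖unitPoint s‖ = 1 := Complex.norm_exp_ofReal_mul_I _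

theorem norm_unitPoint_sub (s r : ℝ) : ‖unitPoint s - unitPoint r‖ = 2 * |Real.sin (s - r)| := by
  have h : unitPoint s - unitPoint r =
      unitPoint r * (Complex.exp (Complex.I * (2 * (s - r) : ℝ)) - 1) := by
    unfold unitPoint
    rw [mul_sub, ← Complex.exp_add, mul_one]
    congr 2
    push_cast
    ring
  rw [h, norm_mul, norm_unitPoint, one_mul, Complex.norm_exp_I_mul_ofReal_sub_one, norm_mul,
    Real.norm_eq_abs, Real.norm_eq_abs, abs_two]
  congr 3
  ring

theorem le_norm_unitPoint_sub {s r : ℝ} (h : |s - r| ≤ Real.pi / 2) :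
    4 / Real.pi * |s - r| ≤ ‖unitPoint s - unitPoint r‖ := by
  rw [norm_unitPoint_sub]
  have h1 := Real.mul_abs_le_abs_sin h
  have : 4 / Real.pi * |s - r| = 2 * (2 / Real.pi * |s - r|) := by ring
  rw [this]
  linarith

/-- Lagrange interpolation at the points `exp (2 i r_j)`. -/
theorem trigPoly_eq_sum_lagrange {n : ℕ} (a : Fin n → ℂ) {r : ℕ → ℝ}
    (hr : Set.InjOn (fun j => unitPoint (r j)) (Finset.range n)) (s : ℝ) :
    trigPoly a s = ∑ j ∈ Finset.range n, trigPoly a (r j) *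
      ∏ m ∈ (Finset.range n).erase j,
        (unitPoint (r j) - unitPoint (r m))⁻¹ * (unitPoint s - unitPoint (r m)) := by
  set P : Polynomial ℂ := ∑ k : Fin n, Polynomial.C (a k) * Polynomial.X ^ (k : ℕ) with hP
  have heval : ∀ s, trigPoly a s = P.eval (unitPoint s) := by
    intro s
    rw [trigPoly, hP, Polynomial.eval_finsetSum]
    refine Finset.sum_congr rfl fun k _ => ?_
    rw [Polynomial.eval_mul, Polynomial.eval_C, Polynomial.eval_pow, Polynomial.eval_X, unitPoint,
      ← Complex.exp_nat_mul]
    congr 2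
    push_cast
    ring
  have hdeg : P.degree < (Finset.range n).card := by
    rw [Finset.card_range]
    exact Polynomial.degree_sum_fin_lt a
  rw [heval s]
  conv_lhs => rw [Lagrange.eq_interpolate hr hdeg]
  rw [Lagrange.interpolate_apply, Polynomial.eval_finsetSum]
  refine Finset.sum_congr rfl fun j _ => ?_
  rw [Polynomial.eval_mul, Polynomial.eval_C, Lagrange.basis, Polynomial.eval_prod, heval]
  simp [Lagrange.basisDivisor]

/-- Control of the coefficients of a trigonometric polynomial by its values at `N + 1` equally
spaced points of an arc. The points `z_j = exp (2 i r_j)` satisfy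
`|z_j - z_m| ≥ 4 y |j - m| / (N + 1)` because the arc has length at most half of the circle; the
Lagrange basis functions are then bounded on the whole circle by multiples of binomial
coefficients, which sum to a power of `2`. -/
theorem sum_norm_sq_le_sum_nodes {N : ℕ} (a : Fin (N + 1) → ℂ) {y : ℝ} (hy : 0 < y)
    (hy2 : y ≤ 1 / 2) (σ : ℝ) :
    ∑ k, ‖a k‖ ^ 2 ≤ (((N + 1) / y) ^ N / N.factorial) ^ 2 *
      ∑ j ∈ Finset.range (N + 1), ‖trigPoly a (σ + j * (Real.pi * y / (N + 1)))‖ ^ 2 := by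
  have hpi := Real.pi_pos
  set r : ℕ → ℝ := fun j => σ + j * (Real.pi * y / (N + 1)) with hr
  have hdiff : ∀ j m : ℕ, |r j - r m| = |(j : ℝ) - m| * (Real.pi * y / (N + 1)) := by
    intro j m
    have : r j - r m = ((j : ℝ) - m) * (Real.pi * y / (N + 1)) := by
      simp only [hr]
      ring
    rw [this, abs_mul, abs_of_pos (by positivity : 0 < Real.pi * y / ((N : ℝ) + 1))]
  have hnode : ∀ j ∈ Finset.range (N + 1), ∀ m ∈ Finset.range (N + 1),
      4 * y / (N + 1) * |(j : ℝ) - m| ≤ ‖unitPoint (r j) - unitPoint (r m)‖ := by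
    intro j hj m hm
    have hj : (j : ℝ) ≤ N := by exact_mod_cast Finset.mem_range_succ_iff.1 hj
    have hm : (m : ℝ) ≤ N := by exact_mod_cast Finset.mem_range_succ_iff.1 hm
    have hjm : |(j : ℝ) - m| ≤ N + 1 :=
      abs_le.2 ⟨by linarith [(Nat.cast_nonneg j : (0 : ℝ) ≤ j)],
        by linarith [(Nat.cast_nonneg m : (0 : ℝ) ≤ m)]⟩
    have h1 : |r j - r m| ≤ Real.pi / 2 := by
      rw [hdiff]
      calc |(j : ℝ) - m| * (Real.pi * y / (N + 1)) ≤ (N + 1) * (Real.pi * y / (N + 1)) := by gcongr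
        _ = Real.pi * y := by field_simp
        _ ≤ Real.pi / 2 := by nlinarith
    refine le_trans (le_of_eq ?_) (le_norm_unitPoint_sub h1)
    rw [hdiff]
    field_simp
  have hpos : ∀ j m : ℕ, m ≠ j → 0 < |(j : ℝ) - m| := fun j m h =>
    abs_pos.2 (sub_ne_zero.2 (by exact_mod_cast h.symm))
  -- distinctness of the nodes, from the separation just proved
  have hinj : Set.InjOn (fun j => unitPoint (r j)) (Finset.range (N + 1)) := by
    intro j hj m hm h
    by_contra hne
    have h1 := hnode j hj m hm
    have h2 : unitPoint (r j) = unitPoint (r m) := h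
    rw [h2, sub_self, norm_zero] at h1
    have h3 := hpos j m (Ne.symm hne)
    have : 0 < 4 * y / ((N : ℝ) + 1) * |(j : ℝ) - m| := by positivity
    linarith
  have hbasis : ∀ s, ∀ j ∈ Finset.range (N + 1),
      ‖∏ m ∈ (Finset.range (N + 1)).erase j,
        (unitPoint (r j) - unitPoint (r m))⁻¹ * (unitPoint s - unitPoint (r m))‖ ≤
      ((N + 1) / (2 * y)) ^ N / N.factorial * N.choose j := by
    intro s j hj
    have hjN : j ≤ N := Finset.mem_range_succ_iff.1 hj
    obtain ⟨i, rfl⟩ := Nat.exists_eq_add_of_le hjN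
    have hfac : ∀ m ∈ (Finset.range (j + i + 1)).erase j,
        ‖(unitPoint (r j) - unitPoint (r m))⁻¹ * (unitPoint s - unitPoint (r m))‖ ≤
          (((j + i : ℕ) + 1) / (2 * y)) * |(j : ℝ) - m|⁻¹ := by
      intro m hm
      have h1 := hnode j hj m (Finset.mem_of_mem_erase hm)
      have h2 := hpos j m (Finset.ne_of_mem_erase hm)
      have h3 : ‖unitPoint s - unitPoint (r m)‖ ≤ 2 := by
        refine (norm_sub_le _ _).trans ?_
        rw [norm_unitPoint, norm_unitPoint]
        norm_num
      rw [norm_mul, norm_inv]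
      calc _ ≤ (4 * y / ((j + i : ℕ) + 1) * |(j : ℝ) - m|)⁻¹ * 2 := by gcongr
        _ = _ := by
          field_simp
          norm_num
    rw [norm_prod]
    refine (Finset.prod_le_prod (fun _ _ => norm_nonneg _) hfac).trans (le_of_eq ?_)
    rw [Finset.prod_mul_distrib, Finset.prod_const, Finset.card_erase_of_mem hj, Finset.card_range,
      Nat.add_sub_cancel, Finset.prod_inv_distrib, show j + i + 1 = j + 1 + i by ring,
      prod_erase_range_abs_sub, Nat.cast_add_choose]
    have h1 : (j.factorial : ℝ) ≠ 0 := by positivity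
    have h2 : (i.factorial : ℝ) ≠ 0 := by positivity
    have h3 : ((j + i).factorial : ℝ) ≠ 0 := by positivity
    field_simp
  set S := ∑ j ∈ Finset.range (N + 1), ‖trigPoly a (r j)‖ ^ 2 with hS
  set M := (((N : ℝ) + 1) / y) ^ N / N.factorial with hM
  have hsup : ∀ s, ‖trigPoly a s‖ ^ 2 ≤ M ^ 2 * S := by
    intro s
    have h1 : ‖trigPoly a s‖ ≤ ∑ j ∈ Finset.range (N + 1), ‖trigPoly a (r j)‖ *
        (((N + 1) / (2 * y)) ^ N / N.factorial * N.choose j) := by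
      rw [trigPoly_eq_sum_lagrange a hinj s]
      refine (norm_sum_le _ _).trans (Finset.sum_le_sum fun j hj => ?_)
      rw [norm_mul]
      exact mul_le_mul_of_nonneg_left (hbasis s j hj) (norm_nonneg _)
    have h2 : ∑ j ∈ Finset.range (N + 1),
        (((N + 1) / (2 * y)) ^ N / N.factorial * N.choose j) = M := by
      rw [← Finset.mul_sum, ← Nat.cast_sum, Nat.sum_range_choose, hM]
      push_cast
      rw [div_mul_eq_mul_div, ← mul_pow]
      congr 2
      field_simp
    calc ‖trigPoly a s‖ ^ 2 ≤ _ := pow_le_pow_left₀ (norm_nonneg _) h1 2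
      _ ≤ _ := Finset.sum_mul_sq_le_sq_mul_sq _ _ _
      _ ≤ S * M ^ 2 := by
        rw [← h2]
        refine mul_le_mul_of_nonneg_left ?_ (Finset.sum_nonneg fun _ _ => by positivity)
        exact Finset.sum_sq_le_sq_sum_of_nonneg fun _ _ => by positivity
      _ = M ^ 2 * S := mul_comm _ _
  have hint : ∫ s in -(Real.pi / 2)..(Real.pi / 2), ‖trigPoly a s‖ ^ 2 ≤
      ∫ _ in -(Real.pi / 2)..(Real.pi / 2), M ^ 2 * S :=
    intervalIntegral.integral_mono_on (by linarith)
      (((continuous_trigPoly a).norm.pow 2).intervalIntegrable _ _)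
      (continuous_const.intervalIntegrable _ _) fun s _ => hsup s
  rw [integral_norm_trigPoly_sq, intervalIntegral.integral_const, smul_eq_mul, sub_neg_eq_add,
    add_halves] at hint
  exact le_of_mul_le_mul_left hint hpi

/-- A Turán-type inequality on an arc in `L²`: `sum_norm_sq_le_sum_nodes` averaged over all
positions of the grid of nodes inside the arc. -/
theorem sum_norm_sq_le_integral_arc {N : ℕ} (a : Fin (N + 1) → ℂ) {y : ℝ} (hy : 0 < y)
    (hy2 : y ≤ 1 / 2) :
    Real.pi * y / (N + 1) * ∑ k, ‖a k‖ ^ 2 ≤ (((N + 1) / y) ^ N / N.factorial) ^ 2 *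
      ∫ s in -(Real.pi * y / 2)..(Real.pi * y / 2), ‖trigPoly a s‖ ^ 2 := by
  have hpi := Real.pi_pos
  set δ := Real.pi * y / ((N : ℝ) + 1) with hδ
  have hδ0 : 0 < δ := by positivity
  set β := Real.pi * y / 2 with hβ
  have hcont : Continuous fun s => ‖trigPoly a s‖ ^ 2 := (continuous_trigPoly a).norm.pow 2
  have hcont' : ∀ j : ℕ, Continuous fun σ => ‖trigPoly a (σ + j * δ)‖ ^ 2 := fun j =>
    hcont.comp (by fun_prop : Continuous fun σ : ℝ => σ + j * δ)
  -- the arc is cut into `N + 1` pieces of length `δ`, which are translated onto the first one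
  have hsplit : ∫ s in -β..β, ‖trigPoly a s‖ ^ 2 =
      ∫ σ in -β..(-β + δ), ∑ j ∈ Finset.range (N + 1), ‖trigPoly a (σ + j * δ)‖ ^ 2 := by
    have h1 := intervalIntegral.sum_integral_adjacent_intervals (f := fun s => ‖trigPoly a s‖ ^ 2)
      (a := fun j : ℕ => -β + j * δ) (n := N + 1) (μ := volume)
      fun j _ => hcont.intervalIntegrable _ _
    have h2 : -β + ((N + 1 : ℕ) : ℝ) * δ = β := by
      rw [hδ, hβ]
      push_cast
      field_simp
      ring
    rw [h2, Nat.cast_zero, zero_mul, add_zero] at h1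
    rw [← h1, intervalIntegral.integral_finsetSum
      fun j _ => (hcont' j).intervalIntegrable _ _]
    refine Finset.sum_congr rfl fun j _ => ?_
    rw [intervalIntegral.integral_comp_add_right (fun s => ‖trigPoly a s‖ ^ 2)]
    congr 1
    push_cast
    ring
  have hmono : ∫ _ in -β..(-β + δ), ∑ k, ‖a k‖ ^ 2 ≤
      ∫ σ in -β..(-β + δ), (((N + 1) / y) ^ N / N.factorial) ^ 2 *
        ∑ j ∈ Finset.range (N + 1), ‖trigPoly a (σ + j * δ)‖ ^ 2 := by
    refine intervalIntegral.integral_mono_on (by linarith)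
      (continuous_const.intervalIntegrable _ _) (Continuous.intervalIntegrable ?_ _ _)
      fun σ _ => sum_norm_sq_le_sum_nodes a hy hy2 σ
    exact continuous_const.mul (continuous_finsetSum _ fun j _ => hcont' j)
  rw [intervalIntegral.integral_const, intervalIntegral.integral_const_mul, ← hsplit, smul_eq_mul]
    at hmono
  simpa using hmono

/-! ### The case `n > 2c/π` -/

/-- A lower bound on `λ_{N+1}(c)` in terms of any arc `|s| ≤ π y / 2` inside `|s| ≤ c / (N + 1)`
with `y ≤ 1/2`. On such an arc `sinc² s ≥ 9/16`. -/
theorem le_eigenvalue_succ {c : ℝ} (hc : 0 < c) (N : ℕ) {y : ℝ} (hy : 0 < y) (hy2 : y ≤ 1 / 2)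
    (hyc : Real.pi * y / 2 ≤ c / (N + 1)) :
    9 / 16 * (y / (N + 1)) * (N.factorial * (y / (N + 1)) ^ N) ^ 2 ≤ eigenvalue c (N + 1) := by
  have hpi := Real.pi_pos
  have hpi4 := Real.pi_le_four
  refine le_eigenvalue_of_le_integral hc (by omega) (β := Real.pi * y / 2) (by positivity)
    (by positivity) (by push_cast; exact hyc) fun a => ?_
  have h1 := integral_mul_mono (F := fun _ => 9 / 16) continuous_const
    (Real.continuous_sinc.pow 2) (β := Real.pi * y / 2) (by positivity)
    ((continuous_trigPoly a).norm.pow 2) (fun s => sq_nonneg _) fun s hs => by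
      have h2 : |s| ≤ 1 := hs.trans (by nlinarith)
      have h3 : s ^ 2 ≤ 1 ^ 2 := sq_le_sq' (abs_le.1 h2).1 (abs_le.1 h2).2
      have h4 : 3 / 4 ≤ Real.sinc s := by linarith [one_sub_sq_div_six_le_sinc s]
      calc (9 / 16 : ℝ) = (3 / 4) ^ 2 := by norm_num
        _ ≤ Real.sinc s ^ 2 := pow_le_pow_left₀ (by norm_num) h4 2
  rw [intervalIntegral.integral_const_mul] at h1
  have h2 := sum_norm_sq_le_integral_arc a hy hy2
  set I := ∫ s in -(Real.pi * y / 2)..(Real.pi * y / 2), ‖trigPoly a s‖ ^ 2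
  have h3 : (N.factorial * (y / ((N : ℝ) + 1)) ^ N) ^ 2 *
      (Real.pi * y / (N + 1) * ∑ k, ‖a k‖ ^ 2) ≤ I := by
    refine (mul_le_mul_of_nonneg_left h2 (by positivity)).trans (le_of_eq ?_)
    rw [← mul_assoc, ← mul_pow]
    have : N.factorial * (y / ((N : ℝ) + 1)) ^ N * (((N + 1) / y) ^ N / N.factorial) = 1 := by
      have : (N.factorial : ℝ) ≠ 0 := by positivity
      rw [div_pow, div_pow]
      field_simp
    rw [this, one_pow, one_mul]
  rw [one_div, ← div_eq_inv_mul, le_div_iff₀ hpi]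
  refine le_trans ?_ h1
  refine le_trans (le_of_eq ?_) (mul_le_mul_of_nonneg_left h3 (by norm_num : (0 : ℝ) ≤ 9 / 16))
  ring

/-- The bound of `le_eigenvalue_succ` with `y = min x (1/2)`, where `x = 2c/(πn)` and `n = N + 1`,
dominates the claimed power bound. Since `y ≥ x / 2`, the choice of `y` costs at most a factor `2`
in the base of the power. -/
theorem power_bound_le_factorial_bound {N : ℕ} {x y : ℝ}
    (hx : 0 < x) (hx1 : x ≤ 1) (hy : y = min x (1 / 2)) :
    7 * (1 - x) ^ 2 * (x / 14) ^ (2 * N + 1) ≤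
      9 / 16 * (y / (N + 1)) * (N.factorial * (y / (N + 1)) ^ N) ^ 2 := by
  have hy0 : 0 < y := hy ▸ lt_min hx (by norm_num)
  have hxy : x / 2 ≤ y := hy ▸ le_min (by linarith) (by linarith)
  have h1 : x * (1 - x) ^ 2 / 2 ≤ 9 / 16 * y := by
    rcases le_total x (1 / 2) with h | h
    · rw [hy, min_eq_left h]
      nlinarith [mul_pos hx hx]
    · rw [hy, min_eq_right h]
      nlinarith [mul_nonneg (sub_nonneg.2 h) (sub_nonneg.2 hx1)]
  have h2 : (x / 14) ^ (2 * N) ≤ 1 / (N + 1) * (N.factorial * (y / (N + 1)) ^ N) ^ 2 := by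
    have h3 := mul_pow_le_mul_factorial_sq N
    calc (x / 14) ^ (2 * N) ≤ (y / 7) ^ (2 * N) := by gcongr ?_ ^ _; linarith
      _ = (y ^ N) ^ 2 / 49 ^ N := by
        rw [div_pow, pow_mul 7, mul_comm 2 N, pow_mul]
        norm_num
      _ ≤ (y ^ N) ^ 2 * (N.factorial ^ 2 / ((N + 1) * ((N + 1) ^ N) ^ 2)) := by
        rw [div_eq_mul_inv]
        refine mul_le_mul_of_nonneg_left ?_ (by positivity)
        rw [inv_eq_one_div, div_le_div_iff₀ (by positivity) (by positivity)]
        linarith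
      _ = _ := by
        rw [div_pow y]
        field_simp
  calc 7 * (1 - x) ^ 2 * (x / 14) ^ (2 * N + 1)
      = (x * (1 - x) ^ 2 / 2) * (x / 14) ^ (2 * N) := by ring
    _ ≤ (9 / 16 * y) * (1 / (N + 1) * (N.factorial * (y / (N + 1)) ^ N) ^ 2) := by gcongr
    _ = _ := by ring

end Prolate

end

theorem mainTheorem8 (c : ℝ) (hc : 0 < c) (n : ℕ) (hn : 1 ≤ n) :
    ((2 / Real.pi) * c < n →
      7 * (1 - 2 * c / (n * Real.pi)) ^ 2 * (c / (7 * Real.pi * n)) ^ (2 * n - 1)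
        ≤ Prolate.eigenvalue c n) ∧
    (n = ⌊(2 / Real.pi) * c⌋₊ →
      4 / (Real.pi + 2 * c) ≤ Prolate.eigenvalue c n) := by
  have hpi := Real.pi_pos
  refine ⟨fun h => ?_, fun h => ?_⟩
  · obtain ⟨N, rfl⟩ := Nat.exists_eq_add_of_le' hn
    rw [div_mul_eq_mul_div, div_lt_iff₀ hpi] at h
    push_cast at h ⊢
    -- `x` is the fraction of the circle covered by the arc `|s| ≤ c / n`
    set x := 2 * c / ((N + 1) * Real.pi) with hx
    have hx0 : 0 < x := by positivity
    have hx1 : x ≤ 1 := by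
      rw [hx, div_le_one (by positivity)]
      exact h.le
    have hexp : 2 * (N + 1) - 1 = 2 * N + 1 := by omega
    have hbase : c / (7 * Real.pi * (N + 1)) = x / 14 := by
      rw [hx]
      field_simp
      norm_num
    rw [hexp, hbase]
    refine (Prolate.power_bound_le_factorial_bound hx0 hx1 rfl).trans
      (Prolate.le_eigenvalue_succ hc N (lt_min hx0 (by norm_num)) (min_le_right _ _) ?_)
    calc Real.pi * min x (1 / 2) / 2 ≤ Real.pi * x / 2 := by gcongr; exact min_le_left _ _
      _ = c / (N + 1) := by
        rw [hx]
        field_simp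
  · refine Prolate.four_div_le_eigenvalue hc hn ?_
    have h1 : (n : ℝ) ≤ (2 / Real.pi) * c := h ▸ Nat.floor_le (by positivity)
    rw [div_mul_eq_mul_div, le_div_iff₀ hpi] at h1
    linarith
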